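/- For a finite connected graph $H$ with distance $d_H$, a vertex $w$ \emph{resolves} two distinct vertices $u,v$ if $d_H(u,w)\neq d_H(v,w)$, and \emph{strongly resolves} them if some shortest $u$-$w$ path contains $v$ or some shortest $v$-$w$ path contains $u$. The metric dimension $\beta(H)$ (respectively the strong dimension $\beta_s(H)$) is the least cardinality of a set $W\subseteq V(H)$ such that every two distinct vertices of $H$ are resolved (respectively strongly resolved) by some $w\in W$. For a finite connected graph $G$, the threshold dimension $\tau(G)$ (respectively the threshold strong dimension $\tau_s(G)$) is the minimum of $\beta(H)$ (respectively of $\beta_s(H)$) over all graphs $H$ with $V(H)=V(G)$ and $E(H)\supseteq E(G)$. Let $G$ be the graph whose vertices are the following 23 points of $\{0,\dots,6\}\times\{0,\dots,6\}$: $$\begin{gathered} w_1=(0,5),\quad w_2=(5,0),\\ a_1=(1,4),\ a_2=(1,5),\ a_3=(1,6),\\ b_1=(2,3),\ b_2=(2,4),\ b_3=(2,5),\ b_4=(2,6),\\ c_1=(3,2),\ c_2=(3,3),\ c_3=(3,4),\ c_4=(3,5),\ c_5=(3,6),\\ d_1=(4,1),\ d_2=(4,2),\ d_3=(4,3),\\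 e_1=(5,1),\ e_2=(5,2),\ e_3=(5,3),\\ f_1=(6,1),\ f_2=(6,2),\ f_3=(6,3), \end{gathered}$$ two distinct points $(x,y)$ and $(x',y')$ being adjacent if and only if $|x-x'|\le 1$ and $|y-y'|\le 1$. Then $\tau(G)=2$ and $\tau_s(G)>2$. In particular, $\tau_s(G)\neq\tau(G)$. -/

import Mathlib

namespace ThresholdDim

variable {V : Type*}

/-- `w` resolves `u` and `v` in `G`: the distances from `u` to `w` and from `v` to `w` differ
(distances in `ℕ∞`, so that vertices in different components are at distance `⊤`). -/
def Resolves (G : SimpleGraph V) (w u v : V) : Prop :=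
  G.edist u w ≠ G.edist v w

/-- There is a shortest `u`-`w` path of `G` that contains `v`. -/
def OnShortestPath (G : SimpleGraph V) (u v w : V) : Prop :=
  ∃ p : G.Walk u w, p.IsPath ∧ p.length = G.dist u w ∧ v ∈ p.support

/-- `w` strongly resolves `u` and `v` in `G`: some shortest `u`-`w` path contains `v`, or some
shortest `v`-`w` path contains `u`. -/
def StronglyResolves (G : SimpleGraph V) (w u v : V) : Prop :=
  OnShortestPath G u v w ∨ OnShortestPath G v u w

/-- Every pair of distinct vertices is resolved by a vertex of `W`. -/
def IsResolvingSet (G : SimpleGraph V) (W : Finset V) : Prop :=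
  ∀ u v : V, u ≠ v → ∃ w ∈ W, Resolves G w u v

/-- Every pair of distinct vertices is strongly resolved by a vertex of `W`. -/
def IsStrongResolvingSet (G : SimpleGraph V) (W : Finset V) : Prop :=
  ∀ u v : V, u ≠ v → ∃ w ∈ W, StronglyResolves G w u v

/-- The metric dimension `β(G)` of a finite graph: the least cardinality of a resolving set. -/
noncomputable def metricDimension (G : SimpleGraph V) : ℕ :=
  sInf {n | ∃ W : Finset V, IsResolvingSet G W ∧ W.card = n}

/-- The strong dimension `β_s(G)` of a finite graph: the least cardinality of a strong
resolving set. -/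
noncomputable def strongDimension (G : SimpleGraph V) : ℕ :=
  sInf {n | ∃ W : Finset V, IsStrongResolvingSet G W ∧ W.card = n}

/-- The threshold dimension `τ(G)`: the least metric dimension of a graph having `G` as a
spanning subgraph. -/
noncomputable def thresholdDimension (G : SimpleGraph V) : ℕ :=
  sInf {n | ∃ H : SimpleGraph V, G ≤ H ∧ metricDimension H = n}

/-- The threshold strong dimension `τ_s(G)`: the least strong dimension of a graph having `G`
as a spanning subgraph. -/
noncomputable def thresholdStrongDimension (G : SimpleGraph V) : ℕ :=
  sInf {n | ∃ H : SimpleGraph V, G ≤ H ∧ strongDimension H = n}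

/-- The 23 vertices of the example graph. -/
inductive ExVertex : Type
  | w1 | w2
  | a1 | a2 | a3
  | b1 | b2 | b3 | b4
  | c1 | c2 | c3 | c4 | c5
  | d1 | d2 | d3
  | e1 | e2 | e3
  | f1 | f2 | f3
  deriving DecidableEq

instance : Fintype ExVertex where
  elems := {.w1, .w2, .a1, .a2, .a3, .b1, .b2, .b3, .b4, .c1, .c2, .c3, .c4, .c5,
    .d1, .d2, .d3, .e1, .e2, .e3, .f1, .f2, .f3}
  complete := fun x => by cases x <;> decide

/-- The positions of the vertices in the drawing, in the grid `{0, …, 6} × {0, …, 6}`. -/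
def ExVertex.pos : ExVertex → ℤ × ℤ
  | .w1 => (0, 5)
  | .a1 => (1, 4) | .a2 => (1, 5) | .a3 => (1, 6)
  | .b1 => (2, 3) | .b2 => (2, 4) | .b3 => (2, 5) | .b4 => (2, 6)
  | .c1 => (3, 2) | .c2 => (3, 3) | .c3 => (3, 4) | .c4 => (3, 5) | .c5 => (3, 6)
  | .d1 => (4, 1) | .d2 => (4, 2) | .d3 => (4, 3)
  | .e1 => (5, 1) | .e2 => (5, 2) | .e3 => (5, 3)
  | .f1 => (6, 1) | .f2 => (6, 2) | .f3 => (6, 3)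
  | .w2 => (5, 0)

/-- The example graph, as the subgraph that its vertices induce in the strong product of two
paths on `{0, …, 6}`: distinct vertices are adjacent exactly when their positions differ by at
most `1` in each coordinate. All 60 edges of the drawing, and no others, arise in this way. -/
def exampleGraph : SimpleGraph ExVertex where
  Adj u v := u ≠ v ∧ |u.pos.1 - v.pos.1| ≤ 1 ∧ |u.pos.2 - v.pos.2| ≤ 1
  symm := ⟨fun u v h => ⟨h.1.symm, by rw [abs_sub_comm]; exact h.2.1,
    by rw [abs_sub_comm]; exact h.2.2⟩⟩
  loopless := ⟨fun _ h => h.1 rfl⟩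

end ThresholdDim

/-!
Fix a graph `H` containing the example graph `G`, and suppose that `s` and `t` strongly resolve all
pairs of vertices of `H`. The map `z ↦ (d_H(s, z), d_H(t, z))` to `ℤ × ℤ` never increases distances
when `ℤ × ℤ` carries the sup (king move) distance, and `w` strongly resolves `u` and `v` only if
`d_H(u, v) = |d_H(u, w) - d_H(v, w)|`. Hence this map is an isometric embedding of `H`
(`dist_le_kingDist_distCoords`).

On the other hand `G` is rigid in the king grid: two adjacent vertices with three common neighbours
cannot be placed diagonally, so the `2 × 2` blocks of `G` force one another's positions, and every
injective placement of `G` in which adjacent vertices are a king move apart is the given drawing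
`ExVertex.pos` up to a symmetry of the grid. In particular it has the same king distances
(`IsKingEmbedding.kingDist_eq`). In the drawing `c5` and
`f3` are at king distance `3`, but no vertex is one move from `c5` and at most two moves from `f3`.
So `d_H(c5, f3) = 3` is impossible, and every such `H` has strong dimension at least `3`.

The statement about the metric dimension is easier. A single vertex cannot resolve a connected graph
that has a vertex of degree `3`, because distances to it take at most three values on a closed
neighbourhood; and in `G` itself the distances to `w1` and `w2` are the two coordinates of the
drawing, so `{w1, w2}` is resolving.
-/

namespace ThresholdDim

/-! ### King moves and rigidity of the drawing -/

/-- The number of king moves between two points of the grid, that is, their sup distance. -/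
def kingDist (p q : ℤ × ℤ) : ℤ := max |p.1 - q.1| |p.2 - q.2|

theorem kingDist_le_iff {p q : ℤ × ℤ} {n : ℤ} :
    kingDist p q ≤ n ↔
      (p.1 - q.1 ≤ n ∧ q.1 - p.1 ≤ n) ∧ (p.2 - q.2 ≤ n ∧ q.2 - p.2 ≤ n) := by
  simp only [kingDist, max_le_iff, abs_le]
  omega

/-- An injective placement of the example graph in the grid under which adjacent vertices are a
king move apart. Vertices that are a king move apart need not be adjacent. -/
structure IsKingEmbedding (φ : ExVertex → ℤ × ℤ) : Prop where
  injective : Function.Injective φ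
  kingDist_le_one : ∀ u v, exampleGraph.Adj u v → kingDist (φ u) (φ v) ≤ 1

instance : DecidableRel exampleGraph.Adj :=
  fun u v => inferInstanceAs
    (Decidable (u ≠ v ∧ |u.pos.1 - v.pos.1| ≤ 1 ∧ |u.pos.2 - v.pos.2| ≤ 1))

namespace IsKingEmbedding

variable {φ : ExVertex → ℤ × ℤ}

/-- King embeddings are preserved by every map of the grid that preserves king distances. -/
theorem comp (h : IsKingEmbedding φ) {σ : ℤ × ℤ → ℤ × ℤ}
    (hσ : ∀ p q, kingDist (σ p) (σ q) = kingDist p q) : IsKingEmbedding (σ ∘ φ) where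
  injective := by
    intro u v huv
    apply h.injective
    have h0 : kingDist (φ u) (φ v) ≤ 0 := by
      rw [← hσ]
      simp only [Function.comp_apply] at huv
      simp [huv, kingDist]
    rw [kingDist_le_iff] at h0
    ext <;> omega
  kingDist_le_one u v huv := by
    simpa only [Function.comp_apply, hσ] using h.kingDist_le_one u v huv

/-- The adjacency condition in coordinates, in a form suited to linear arithmetic. -/
theorem adj (h : IsKingEmbedding φ) (u v : ExVertex)
    (huv : exampleGraph.Adj u v := by decide) :
    ((φ u).1 - (φ v).1 ≤ 1 ∧ (φ v).1 - (φ u).1 ≤ 1) ∧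
      ((φ u).2 - (φ v).2 ≤ 1 ∧ (φ v).2 - (φ u).2 ≤ 1) :=
  kingDist_le_iff.1 (h.kingDist_le_one u v huv)

theorem ne (h : IsKingEmbedding φ) (u v : ExVertex) (huv : u ≠ v := by decide) :
    (φ u).1 ≠ (φ v).1 ∨ (φ u).2 ≠ (φ v).2 := by
  by_contra! hc
  exact huv (h.injective (Prod.ext hc.1 hc.2))

/-- Two grid points a diagonal move apart have only two common neighbours, so adjacent vertices
with three common neighbours agree in one coordinate. -/
theorem aligned (h : IsKingEmbedding φ) (p q r₁ r₂ r₃ : ExVertex)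
    (hpq : exampleGraph.Adj p q := by decide)
    (hr : ∀ r ∈ [r₁, r₂, r₃], exampleGraph.Adj p r ∧ exampleGraph.Adj q r := by decide)
    (hne : r₁ ≠ r₂ ∧ r₁ ≠ r₃ ∧ r₂ ≠ r₃ := by decide) :
    (φ p).1 = (φ q).1 ∨ (φ p).2 = (φ q).2 := by
  simp only [List.forall_mem_cons] at hr
  obtain ⟨⟨hp1, hq1⟩, ⟨hp2, hq2⟩, ⟨hp3, hq3⟩, -⟩ := hr
  by_contra! hc
  have k1 : ∀ r, exampleGraph.Adj p r → exampleGraph.Adj q r →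
      ((φ r).1 = (φ p).1 ∧ (φ r).2 = (φ q).2) ∨ ((φ r).1 = (φ q).1 ∧ (φ r).2 = (φ p).2) := by
    intro r h1 h2
    have := h.adj p q hpq
    have := h.adj p r h1
    have := h.adj q r h2
    have := h.ne p r h1.ne
    have := h.ne q r h2.ne
    omega
  have := k1 r₁ hp1 hq1
  have := k1 r₂ hp2 hq2
  have := k1 r₃ hp3 hq3
  have := h.ne r₁ r₂ hne.1
  have := h.ne r₁ r₃ hne.2.1
  have := h.ne r₂ r₃ hne.2.2
  omega

open ExVertex in
/-- Once `b3`, `c4` and `b4` are placed as in the drawing, all vertices are: each is confined by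
neighbours already placed and must avoid the occupied points. -/
theorem eq_pos (h : IsKingEmbedding φ) (hb3 : φ b3 = (2, 5)) (hc4 : φ c4 = (3, 5))
    (hb4 : φ b4 = (2, 6)) : φ = ExVertex.pos := by
  have hc5 : φ c5 = (3, 6) := by
    have := h.adj c5 b3; have := h.adj c5 b4; have := h.adj c5 c4
    have := h.ne c5 b3; have := h.ne c5 b4; have := h.ne c5 c4
    rw [Prod.ext_iff]; simp only [*] at *; omega
  -- `a2` and `b2` both have two candidate positions; only one choice is compatible with `a2 ~ b2`.
  have hab : φ a2 = (1, 5) ∧ φ b2 = (2, 4) := by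
    have := h.adj a2 b3; have := h.adj a2 b4; have := h.adj b2 b3; have := h.adj b2 c4
    have := h.adj a2 b2
    have := h.ne a2 b3; have := h.ne a2 b4; have := h.ne a2 c4; have := h.ne a2 c5
    have := h.ne b2 b3; have := h.ne b2 b4; have := h.ne b2 c4; have := h.ne b2 c5
    rw [Prod.ext_iff, Prod.ext_iff]; simp only [*] at *; omega
  obtain ⟨ha2, hb2⟩ := hab
  have ha3 : φ a3 = (1, 6) := by
    have := h.adj a3 b3; have := h.adj a3 b4
    have := h.ne a3 b3; have := h.ne a3 b4; have := h.ne a3 c4; have := h.ne a3 c5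
    have := h.ne a3 a2
    rw [Prod.ext_iff]; simp only [*] at *; omega
  have hc3 : φ c3 = (3, 4) := by
    have := h.adj c3 b3; have := h.adj c3 c4
    have := h.ne c3 b3; have := h.ne c3 b4; have := h.ne c3 c4; have := h.ne c3 c5
    have := h.ne c3 b2
    rw [Prod.ext_iff]; simp only [*] at *; omega
  have ha1 : φ a1 = (1, 4) := by
    have := h.adj a1 a2; have := h.adj a1 b2; have := h.adj a1 b3
    have := h.ne a1 a2; have := h.ne a1 b2; have := h.ne a1 b3
    rw [Prod.ext_iff]; simp only [*] at *; omega
  have hb1 : φ b1 = (2, 3) := by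
    have := h.adj b1 a1; have := h.adj b1 b2; have := h.adj b1 c3
    have := h.ne b1 b2; have := h.ne b1 b3
    rw [Prod.ext_iff]; simp only [*] at *; omega
  have hc2 : φ c2 = (3, 3) := by
    have := h.adj c2 b1; have := h.adj c2 b2; have := h.adj c2 c3
    have := h.ne c2 b1; have := h.ne c2 b2; have := h.ne c2 c3
    rw [Prod.ext_iff]; simp only [*] at *; omega
  have hcd : φ c1 = (3, 2) ∧ φ d3 = (4, 3) := by
    have := h.adj c1 b1; have := h.adj c1 c2; have := h.adj d3 c2; have := h.adj d3 c3
    have := h.adj c1 d3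
    have := h.ne c1 b1; have := h.ne c1 c2; have := h.ne c1 b2; have := h.ne c1 c3
    have := h.ne d3 b1; have := h.ne d3 c2; have := h.ne d3 b2; have := h.ne d3 c3
    rw [Prod.ext_iff, Prod.ext_iff]; simp only [*] at *; omega
  obtain ⟨hc1, hd3⟩ := hcd
  have hd2 : φ d2 = (4, 2) := by
    have := h.adj d2 c1; have := h.adj d2 d3; have := h.adj d2 c2
    have := h.ne d2 c1; have := h.ne d2 d3; have := h.ne d2 c2
    rw [Prod.ext_iff]; simp only [*] at *; omega
  have hde : φ d1 = (4, 1) ∧ φ e2 = (5, 2) := by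
    have := h.adj d1 c1; have := h.adj d1 d2; have := h.adj e2 d2; have := h.adj e2 d3
    have := h.adj d1 e2
    have := h.ne d1 c1; have := h.ne d1 d2; have := h.ne d1 c2; have := h.ne d1 d3
    have := h.ne e2 c1; have := h.ne e2 d2; have := h.ne e2 c2; have := h.ne e2 d3
    rw [Prod.ext_iff, Prod.ext_iff]; simp only [*] at *; omega
  obtain ⟨hd1, he2⟩ := hde
  have he3 : φ e3 = (5, 3) := by
    have := h.adj e3 d2; have := h.adj e3 d3
    have := h.ne e3 c1; have := h.ne e3 d2; have := h.ne e3 c2; have := h.ne e3 d3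
    have := h.ne e3 e2
    rw [Prod.ext_iff]; simp only [*] at *; omega
  have he1 : φ e1 = (5, 1) := by
    have := h.adj e1 d1; have := h.adj e1 d2; have := h.adj e1 e2
    have := h.ne e1 d1; have := h.ne e1 d2; have := h.ne e1 e2
    rw [Prod.ext_iff]; simp only [*] at *; omega
  have hf2 : φ f2 = (6, 2) := by
    have := h.adj f2 e1; have := h.adj f2 e2; have := h.adj f2 e3
    have := h.ne f2 e2; have := h.ne f2 d2
    rw [Prod.ext_iff]; simp only [*] at *; omega
  have hf3 : φ f3 = (6, 3) := by
    have := h.adj f3 e2; have := h.adj f3 e3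
    have := h.ne f3 e2; have := h.ne f3 e3; have := h.ne f3 d2; have := h.ne f3 d3
    have := h.ne f3 f2
    rw [Prod.ext_iff]; simp only [*] at *; omega
  have hf1 : φ f1 = (6, 1) := by
    have := h.adj f1 e1; have := h.adj f1 e2
    have := h.ne f1 e1; have := h.ne f1 e2; have := h.ne f1 d1; have := h.ne f1 d2
    have := h.ne f1 f2
    rw [Prod.ext_iff]; simp only [*] at *; omega
  have hw1 : φ w1 = (0, 5) := by
    have := h.adj w1 a1; have := h.adj w1 a3
    have := h.ne w1 a2; have := h.ne w1 b3
    rw [Prod.ext_iff]; simp only [*] at *; omega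
  have hw2 : φ w2 = (5, 0) := by
    have := h.adj w2 d1; have := h.adj w2 f1
    have := h.ne w2 e1; have := h.ne w2 e2
    rw [Prod.ext_iff]; simp only [*] at *; omega
  funext z
  cases z <;> simp only [ExVertex.pos, *]

open ExVertex in
/-- **Rigidity**: every king embedding of the example graph has the king distances of the
drawing. -/
theorem kingDist_eq (h : IsKingEmbedding φ) (u v : ExVertex) :
    kingDist (φ u) (φ v) = kingDist u.pos v.pos := by
  -- It is enough to find a symmetry of the grid that moves `b3`, `c4`, `b4` to the drawing.
  suffices hσ : ∃ σ : ℤ × ℤ → ℤ × ℤ, (∀ p q, kingDist (σ p) (σ q) = kingDist p q) ∧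
      σ (φ b3) = (2, 5) ∧ σ (φ c4) = (3, 5) ∧ σ (φ b4) = (2, 6) by
    obtain ⟨σ, hσ, h1, h2, h3⟩ := hσ
    rw [← (h.comp hσ).eq_pos h1 h2 h3]
    exact (hσ _ _).symm
  have habs : ∀ a : ℤ, (a = 1 ∨ a = -1) → ∀ x y c k : ℤ,
      |(k + a * (x - c)) - (k + a * (y - c))| = |x - y| := by
    intro a ha x y c k
    rw [show (k + a * (x - c)) - (k + a * (y - c)) = a * (x - y) by ring, abs_mul]
    rcases ha with rfl | rfl <;> simp
  have hb := h.aligned b3 b4 a2 a3 c4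
  have hc := h.aligned b3 c4 b2 c3 b4
  have := h.adj b3 b4; have := h.adj b3 c4; have := h.adj b4 c4
  have := h.ne b3 b4; have := h.ne b3 c4; have := h.ne b4 c4
  generalize φ b3 = p at *
  generalize φ b4 = q at *
  generalize φ c4 = r at *
  obtain ⟨p1, p2⟩ := p
  obtain ⟨q1, q2⟩ := q
  obtain ⟨r1, r2⟩ := r
  dsimp only at *
  rcases hb with hb | hb
  · have hr : r2 = p2 := by omega
    have ha : r1 - p1 = 1 ∨ r1 - p1 = -1 := by omega
    have hb' : q2 - p2 = 1 ∨ q2 - p2 = -1 := by omega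
    refine ⟨fun z => (2 + (r1 - p1) * (z.1 - p1), 5 + (q2 - p2) * (z.2 - p2)), ?_, ?_⟩
    · intro z z'
      simp only [kingDist, habs _ ha, habs _ hb']
    · subst hr hb
      rcases ha with ha | ha <;> rcases hb' with hb' | hb' <;> simp [ha, hb']
  · have hr : r1 = p1 := by omega
    have ha : r2 - p2 = 1 ∨ r2 - p2 = -1 := by omega
    have hb' : q1 - p1 = 1 ∨ q1 - p1 = -1 := by omega
    refine ⟨fun z => (2 + (r2 - p2) * (z.2 - p2), 5 + (q1 - p1) * (z.1 - p1)), ?_, ?_⟩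
    · intro z z'
      simp only [kingDist, habs _ ha, habs _ hb', max_comm]
    · subst hr hb
      rcases ha with ha | ha <;> rcases hb' with hb' | hb' <;> simp [ha, hb']

end IsKingEmbedding

/-! ### Distances in the example graph -/

section
variable {V : Type*} {G : SimpleGraph V}

/-- A function that vanishes only at `w`, is 1-Lipschitz, and can be decreased by moving along an
edge wherever it is positive is the distance to `w`. -/
theorem reachable_and_dist_eq {w : V} {f : V → ℕ} (h0 : ∀ u, f u = 0 ↔ u = w)
    (hlip : ∀ u v, G.Adj u v → f u ≤ f v + 1)
    (hdec : ∀ u, f u ≠ 0 → ∃ v, G.Adj u v ∧ f v + 1 = f u) (u : V) :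
    G.Reachable u w ∧ G.dist u w = f u := by
  have hwalk : ∀ u, ∃ p : G.Walk u w, p.length = f u := by
    intro u
    induction hn : f u generalizing u with
    | zero =>
      obtain rfl := (h0 u).1 hn
      exact ⟨.nil, rfl⟩
    | succ n ih =>
      obtain ⟨v, huv, hv⟩ := hdec u (by omega)
      obtain ⟨p, hp⟩ := ih v (by omega)
      exact ⟨.cons huv p, by simp [hp]⟩
  have hle : ∀ {u v : V} (p : G.Walk u v), f u ≤ f v + p.length := by
    intro u v p
    induction p with
    | nil => simp
    | cons huv p ih =>
      have := hlip _ _ huv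
      rw [SimpleGraph.Walk.length_cons]
      omega
  obtain ⟨p, hp⟩ := hwalk u
  refine ⟨p.reachable, le_antisymm (hp ▸ SimpleGraph.dist_le p) ?_⟩
  obtain ⟨q, hq⟩ := p.reachable.exists_walk_length_eq_dist
  have := hle q
  rw [(h0 w).2 rfl] at this
  omega

end

theorem exampleGraph_dist_w1 (u : ExVertex) :
    exampleGraph.Reachable u .w1 ∧ exampleGraph.dist u .w1 = u.pos.1.toNat :=
  reachable_and_dist_eq (f := fun u => u.pos.1.toNat)
    (by decide) (by decide) (by decide) u

theorem exampleGraph_dist_w2 (u : ExVertex) :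
    exampleGraph.Reachable u .w2 ∧ exampleGraph.dist u .w2 = u.pos.2.toNat :=
  reachable_and_dist_eq (f := fun u => u.pos.2.toNat)
    (by decide) (by decide) (by decide) u

theorem exampleGraph_connected : exampleGraph.Connected :=
  (SimpleGraph.connected_iff _).2
    ⟨fun u v => (exampleGraph_dist_w1 u).1.trans (exampleGraph_dist_w1 v).1.symm, ⟨.w1⟩⟩

theorem isResolvingSet_w1_w2 : IsResolvingSet exampleGraph {.w1, .w2} := by
  have hpos : ∀ u v : ExVertex, u.pos.1.toNat = v.pos.1.toNat →
      u.pos.2.toNat = v.pos.2.toNat → u = v := by decide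
  intro u v huv
  by_contra! hc
  simp only [Finset.mem_insert, Finset.mem_singleton, forall_eq_or_imp, forall_eq, Resolves,
    not_not] at hc
  obtain ⟨h1, h2⟩ := hc
  rw [← (exampleGraph_dist_w1 u).1.coe_dist_eq_edist,
    ← (exampleGraph_dist_w1 v).1.coe_dist_eq_edist, (exampleGraph_dist_w1 u).2,
    (exampleGraph_dist_w1 v).2, Nat.cast_inj] at h1
  rw [← (exampleGraph_dist_w2 u).1.coe_dist_eq_edist,
    ← (exampleGraph_dist_w2 v).1.coe_dist_eq_edist, (exampleGraph_dist_w2 u).2,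
    (exampleGraph_dist_w2 v).2, Nat.cast_inj] at h2
  exact huv (hpos u v h1 h2)

/-! ### Resolving sets of connected graphs -/

section
variable {V : Type*} {H : SimpleGraph V}

theorem isResolvingSet_univ [Fintype V] (H : SimpleGraph V) : IsResolvingSet H Finset.univ :=
  fun u v huv => ⟨v, Finset.mem_univ v, by
    simpa [Resolves, SimpleGraph.edist_eq_zero_iff] using huv⟩

theorem isStrongResolvingSet_univ [Fintype V] (hH : H.Connected) :
    IsStrongResolvingSet H Finset.univ := by
  intro u v _
  obtain ⟨p, hp, hl⟩ := hH.exists_path_of_dist u v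
  exact ⟨v, Finset.mem_univ v, Or.inl ⟨p, hp, hl, p.end_mem_support⟩⟩

theorem dist_le_dist_add_one (hH : H.Connected) {u v : V} (huv : H.Adj u v) (w : V) :
    H.dist u w ≤ H.dist v w + 1 := by
  have := hH.dist_triangle (u := u) (v := v) (w := w)
  rw [SimpleGraph.dist_eq_one_iff_adj.2 huv] at this
  omega

/-- No single vertex resolves a connected graph with a vertex of degree at least `3`: the distances
to it take at most three values on the closed neighbourhood of that vertex. -/
theorem two_le_card_of_isResolvingSet (hH : H.Connected) {x a b c : V} (ha : H.Adj x a)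
    (hb : H.Adj x b) (hc : H.Adj x c) (hab : a ≠ b) (hac : a ≠ c) (hbc : b ≠ c) {W : Finset V}
    (hW : IsResolvingSet H W) : 2 ≤ W.card := by
  by_contra! hlt
  have key : ∀ w : V, ∃ u v, u ≠ v ∧ H.dist u w = H.dist v w := by
    intro w
    by_contra! hinj
    have := dist_le_dist_add_one hH ha w
    have := dist_le_dist_add_one hH hb w
    have := dist_le_dist_add_one hH hc w
    have := dist_le_dist_add_one hH ha.symm w
    have := dist_le_dist_add_one hH hb.symm w
    have := dist_le_dist_add_one hH hc.symm w
    have := hinj x a ha.ne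
    have := hinj x b hb.ne
    have := hinj x c hc.ne
    have := hinj a b hab
    have := hinj a c hac
    have := hinj b c hbc
    omega
  have : Nonempty V := ⟨x⟩
  obtain ⟨w₀, hw₀⟩ := Finset.card_le_one_iff_subset_singleton.1 (Nat.lt_succ_iff.1 hlt)
  obtain ⟨u, v, huv, hd⟩ := key w₀
  obtain ⟨w', hw', hres⟩ := hW u v huv
  obtain rfl := Finset.mem_singleton.1 (hw₀ hw')
  exact hres (by rw [← (hH u w').coe_dist_eq_edist, ← (hH v w').coe_dist_eq_edist, hd])

theorem OnShortestPath.dist_add_dist (hH : H.Connected) {u v w : V} (h : OnShortestPath H u v w) :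
    H.dist u v + H.dist v w = H.dist u w := by
  classical
  obtain ⟨p, -, hl, hv⟩ := h
  have h1 := SimpleGraph.dist_le (p.takeUntil v hv)
  have h2 := SimpleGraph.dist_le (p.dropUntil v hv)
  have h3 := congrArg SimpleGraph.Walk.length (p.take_spec hv)
  rw [SimpleGraph.Walk.length_append] at h3
  have := hH.dist_triangle (u := u) (v := v) (w := w)
  omega

/-- The distances to two fixed vertices `s` and `t`, as coordinates in the grid. -/
noncomputable def distCoords (H : SimpleGraph V) (s t z : V) : ℤ × ℤ :=
  (H.dist z s, H.dist z t)

theorem kingDist_distCoords_le (hH : H.Connected) (s t u v : V) :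
    kingDist (distCoords H s t u) (distCoords H s t v) ≤ H.dist u v := by
  have h1 := hH.dist_triangle (u := u) (v := v) (w := s)
  have h2 := hH.dist_triangle (u := v) (v := u) (w := s)
  have h3 := hH.dist_triangle (u := u) (v := v) (w := t)
  have h4 := hH.dist_triangle (u := v) (v := u) (w := t)
  rw [SimpleGraph.dist_comm (u := v) (v := u)] at h2 h4
  rw [kingDist_le_iff]
  simp only [distCoords]
  omega

/-- If `s` and `t` strongly resolve all pairs, their distance coordinates do not decrease
distances either. -/
theorem dist_le_kingDist_distCoords (hH : H.Connected) {W : Finset V} {s t : V}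
    (hW : IsStrongResolvingSet H W) (hst : ∀ w ∈ W, w = s ∨ w = t) (u v : V) :
    (H.dist u v : ℤ) ≤ kingDist (distCoords H s t u) (distCoords H s t v) := by
  obtain rfl | huv := eq_or_ne u v
  · simp [kingDist]
  obtain ⟨w, hw, hres⟩ := hW u v huv
  have key : (H.dist u v : ℤ) ≤ |(H.dist u w : ℤ) - H.dist v w| := by
    rcases hres with h | h
    · have := h.dist_add_dist hH
      rw [le_abs]
      omega
    · have := h.dist_add_dist hH
      rw [SimpleGraph.dist_comm] at this
      rw [le_abs]
      omega
  obtain rfl | rfl := hst w hw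
  · exact key.trans (le_max_left _ _)
  · exact key.trans (le_max_right _ _)

end

/-! ### Supergraphs of the example graph -/

theorem two_le_metricDimension {H : SimpleGraph ExVertex} (hGH : exampleGraph ≤ H) :
    2 ≤ metricDimension H := by
  obtain ⟨W, hW, hcard⟩ := Nat.sInf_mem
    (s := {n | ∃ W : Finset ExVertex, IsResolvingSet H W ∧ W.card = n})
    ⟨_, _, isResolvingSet_univ H, rfl⟩
  have hadj : ∀ u v, exampleGraph.Adj u v → H.Adj u v := fun u v h => hGH h
  rw [metricDimension, ← hcard]
  exact two_le_card_of_isResolvingSet (exampleGraph_connected.mono hGH)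
    (hadj .b3 .a1 (by decide)) (hadj .b3 .a2 (by decide)) (hadj .b3 .a3 (by decide))
    (by decide) (by decide) (by decide) hW

theorem two_lt_strongDimension {H : SimpleGraph ExVertex} (hGH : exampleGraph ≤ H) :
    2 < strongDimension H := by
  have hH : H.Connected := exampleGraph_connected.mono hGH
  obtain ⟨W, hW, hcard⟩ := Nat.sInf_mem
    (s := {n | ∃ W : Finset ExVertex, IsStrongResolvingSet H W ∧ W.card = n})
    ⟨_, _, isStrongResolvingSet_univ hH, rfl⟩
  rw [strongDimension, ← hcard]
  by_contra! hle
  obtain ⟨s, t, hst⟩ : ∃ s t, ∀ w ∈ W, w = s ∨ w = t := by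
    obtain ⟨W', hWW', hW'⟩ := Finset.exists_superset_card_eq hle (by decide)
    obtain ⟨s, t, -, rfl⟩ := Finset.card_eq_two.1 hW'
    exact ⟨s, t, fun w hw => by simpa using hWW' hw⟩
  have hge := dist_le_kingDist_distCoords hH hW hst
  have hle' := kingDist_distCoords_le hH s t
  have hemb : IsKingEmbedding (distCoords H s t) := by
    refine ⟨fun u v huv => ?_, fun u v huv => ?_⟩
    · have := hge u v
      rw [huv] at this
      rw [← hH.dist_eq_zero_iff]
      simpa [kingDist] using this
    · have := hle' u v
      rwa [SimpleGraph.dist_eq_one_iff_adj.2 (hGH huv), Nat.cast_one] at this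
  have hrigid := hemb.kingDist_eq
  -- The second vertex `z` of a shortest path from `c5` to `f3` would have to lie at king distance
  -- at most `1` from `c5` and at most `2` from `f3`, where the drawing has no vertex.
  have hdist : (H.dist .c5 .f3 : ℤ) ≤ 3 := (hge _ _).trans (by rw [hrigid]; decide)
  obtain ⟨p, hp⟩ := (hH ExVertex.c5 ExVertex.f3).exists_walk_length_eq_dist
  cases p with
  | @cons _ z _ hz q =>
    rw [SimpleGraph.Walk.length_cons] at hp
    have h1 := hle' .c5 z
    rw [SimpleGraph.dist_eq_one_iff_adj.2 hz, hrigid] at h1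
    have h2 := hle' z .f3
    rw [hrigid] at h2
    have hq := SimpleGraph.dist_le q
    have hno : ∀ z : ExVertex, kingDist ExVertex.c5.pos z.pos ≤ 1 →
        ¬ kingDist z.pos ExVertex.f3.pos ≤ 2 := by decide
    exact hno z h1 (h2.trans (by omega))

theorem thresholdDimension_exampleGraph : thresholdDimension exampleGraph = 2 := by
  apply le_antisymm
  · have h1 : thresholdDimension exampleGraph ≤ metricDimension exampleGraph :=
      Nat.sInf_le ⟨exampleGraph, le_rfl, rfl⟩
    have h2 : metricDimension exampleGraph ≤ 2 :=
      Nat.sInf_le ⟨_, isResolvingSet_w1_w2, by decide⟩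
    exact h1.trans h2
  · obtain ⟨H, hGH, hH⟩ := Nat.sInf_mem
      (s := {n | ∃ H : SimpleGraph ExVertex, exampleGraph ≤ H ∧ metricDimension H = n})
      ⟨_, exampleGraph, le_rfl, rfl⟩
    rw [thresholdDimension, ← hH]
    exact two_le_metricDimension hGH

theorem two_lt_thresholdStrongDimension_exampleGraph :
    2 < thresholdStrongDimension exampleGraph := by
  obtain ⟨H, hGH, hH⟩ := Nat.sInf_mem
    (s := {n | ∃ H : SimpleGraph ExVertex, exampleGraph ≤ H ∧ strongDimension H = n})
    ⟨_, exampleGraph, le_rfl, rfl⟩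
  rw [thresholdStrongDimension, ← hH]
  exact two_lt_strongDimension hGH

end ThresholdDim

theorem mainTheorem3 :
    ThresholdDim.thresholdDimension ThresholdDim.exampleGraph = 2 ∧
      2 < ThresholdDim.thresholdStrongDimension ThresholdDim.exampleGraph ∧
      ThresholdDim.thresholdStrongDimension ThresholdDim.exampleGraph ≠
        ThresholdDim.thresholdDimension ThresholdDim.exampleGraph := by
  have h1 := ThresholdDim.thresholdDimension_exampleGraph
  have h2 := ThresholdDim.two_lt_thresholdStrongDimension_exampleGraph
  exact ⟨h1, h2, by omega⟩
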